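/- Let $X\subseteq\mathbb R^d$ be a nonempty closed convex set, let $f,g_1,\dots,g_m:\mathbb R^d\to\mathbb R$ be convex continuous functions, and consider the problem of minimizing $f(x)$ over all $x\in X$ with $g_i(x)\le 0$, $1\le i\le m$. For $\eta\in\mathbb R$ put $$v(x,\eta)=\max\{f(x)-\eta,\,g_1(x),\dots,g_m(x)\},\qquad V(\eta)=\inf_{x\in X}v(x,\eta),\qquad S(\eta)=\operatorname*{argmin}_{x\in X}v(x,\eta),\qquad \eta^*=\inf\{\eta: V(\eta)=0\}.$$ Write $\partial$ for the convex subdifferential and $\mathcal N_X(x)=\{z:\langle z,x-y\rangle\ge 0\ \forall y\in X\}$ for the normal cone. Let $\Lambda(x,\eta)$ be the set of all $\lambda=(\lambda_0,\dots,\lambda_m)$ with $\lambda_i\ge 0$ and $\sum_{i=0}^m\lambda_i=1$ such that $\lambda_0=0$ if $f(x)-\eta<v(x,\eta)$, and $\lambda_i=0$ if $g_i(x)<v(x,\eta)$, $1\le i\le m$. Then, for every $\eta\in\mathbb R$, $$\partial V(\eta)\ \supseteq\ \bigcup_{x\in S(\eta)}\Big\{-\lambda_0:\ 0\in\lambda_0\,\partial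 f(x)+\sum_{j=1}^m\lambda_j\,\partial g_j(x)+\mathcal N_X(x),\ \lambda\in\Lambda(x,\eta)\Big\}.$$ Moreover, let $x^*$ be an optimal solution of the constrained problem at which the KKT condition holds, i.e. there is a vector of Lagrange multipliers $y^*\in\mathbb R^m_+$, meaning that $y_i^*g_i(x^*)=0$ for all $i$ and $0\in\partial f(x^*)+\sum_{j=1}^m y_j^*\,\partial g_j(x^*)+\mathcal N_X(x^*)$. Then $\eta^*=f(x^*)$ and $$\partial V(\eta^*)\ \supseteq\ \Big\{-\frac{1}{1+\|y^*\|_1}:\ y^*\in\mathbb R^m_+\text{ is a vector of Lagrange multipliers at } x^*\Big\}.$$ The KKT condition holds at every optimal solution if, for example, Slater's condition holds, i.e. there is $x\in X$ with $g_i(x)<0$ for all $i$. -/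

import Mathlib

open scoped Pointwise

noncomputable section

namespace LevelSet

/-- The convex subdifferential of `h` at `x`: all `s` with `h x + ⟪s, y - x⟫ ≤ h y` for every `y`. -/
def subdifferential {E : Type*} [NormedAddCommGroup E] [InnerProductSpace ℝ E]
    (h : E → ℝ) (x : E) : Set E :=
  {s | ∀ y, h x + inner ℝ s (y - x) ≤ h y}

/-- The normal cone to `X` at `x`. -/
def normalCone {E : Type*} [NormedAddCommGroup E] [InnerProductSpace ℝ E]
    (X : Set E) (x : E) : Set E :=
  {z | ∀ y ∈ X, 0 ≤ inner ℝ z (x - y)}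

section Problem

variable {d m : ℕ}

/-- The pieces `f x - η, g₁ x, …, g_m x`; index `0` is the objective piece and
index `i.succ` is the `i`-th constraint piece. -/
def piece (f : EuclideanSpace ℝ (Fin d) → ℝ) (g : Fin m → EuclideanSpace ℝ (Fin d) → ℝ)
    (x : EuclideanSpace ℝ (Fin d)) (η : ℝ) : Fin (m + 1) → ℝ :=
  Fin.cons (f x - η) (fun i => g i x)

/-- `v(x, η) = max {f x - η, g₁ x, …, g_m x}`. -/
def maxFun (f : EuclideanSpace ℝ (Fin d) → ℝ) (g : Fin m → EuclideanSpace ℝ (Fin d) → ℝ)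
    (x : EuclideanSpace ℝ (Fin d)) (η : ℝ) : ℝ :=
  Finset.univ.sup' Finset.univ_nonempty (piece f g x η)

/-- The optimal value function `V(η)`, the infimum of `v(·, η)` over `X`. (If `v(·, η₀)` attains
its minimum over `X` for one `η₀`, this is a genuine infimum at every `η`,
see `isGLB_valueFun` below.) -/
def valueFun (f : EuclideanSpace ℝ (Fin d) → ℝ) (g : Fin m → EuclideanSpace ℝ (Fin d) → ℝ)
    (X : Set (EuclideanSpace ℝ (Fin d))) (η : ℝ) : ℝ :=
  sInf ((fun x => maxFun f g x η) '' X)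

/-- `S(η)`, the set of minimizers of `v(·, η)` over `X`. -/
def solutionSet (f : EuclideanSpace ℝ (Fin d) → ℝ) (g : Fin m → EuclideanSpace ℝ (Fin d) → ℝ)
    (X : Set (EuclideanSpace ℝ (Fin d))) (η : ℝ) : Set (EuclideanSpace ℝ (Fin d)) :=
  {x | x ∈ X ∧ IsMinOn (fun z => maxFun f g z η) X x}

/-- `Λ(x, η)`: the points of the standard simplex that vanish on the inactive pieces. -/
def activeSimplex (f : EuclideanSpace ℝ (Fin d) → ℝ)
    (g : Fin m → EuclideanSpace ℝ (Fin d) → ℝ)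
    (x : EuclideanSpace ℝ (Fin d)) (η : ℝ) : Set (Fin (m + 1) → ℝ) :=
  {l | l ∈ stdSimplex ℝ (Fin (m + 1)) ∧ ∀ i, piece f g x η i < maxFun f g x η → l i = 0}

/-- The Fritz–John multipliers at `(x, η)`: those `l ∈ Λ(x, η)` with
`0 ∈ l₀ ∂f(x) + ∑ⱼ lⱼ ∂gⱼ(x) + N_X(x)`. -/
def fritzJohn (f : EuclideanSpace ℝ (Fin d) → ℝ) (g : Fin m → EuclideanSpace ℝ (Fin d) → ℝ)
    (X : Set (EuclideanSpace ℝ (Fin d))) (x : EuclideanSpace ℝ (Fin d)) (η : ℝ) :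
    Set (Fin (m + 1) → ℝ) :=
  {l | l ∈ activeSimplex f g x η ∧
    (0 : EuclideanSpace ℝ (Fin d)) ∈ l 0 • subdifferential f x
      + (∑ j : Fin m, l j.succ • subdifferential (g j) x) + normalCone X x}

/-- The level `η* = inf {η : V(η) = 0}`. -/
def etaStar (f : EuclideanSpace ℝ (Fin d) → ℝ) (g : Fin m → EuclideanSpace ℝ (Fin d) → ℝ)
    (X : Set (EuclideanSpace ℝ (Fin d))) : ℝ :=
  sInf {η | valueFun f g X η = 0}

/-- The feasible set of `min {f x : x ∈ X, gᵢ x ≤ 0 for all i}`. -/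
def feasibleSet (g : Fin m → EuclideanSpace ℝ (Fin d) → ℝ)
    (X : Set (EuclideanSpace ℝ (Fin d))) : Set (EuclideanSpace ℝ (Fin d)) :=
  {x | x ∈ X ∧ ∀ i, g i x ≤ 0}

/-- `x` is an optimal solution of `min {f x : x ∈ X, gᵢ x ≤ 0 for all i}`. -/
def IsOptimal (f : EuclideanSpace ℝ (Fin d) → ℝ) (g : Fin m → EuclideanSpace ℝ (Fin d) → ℝ)
    (X : Set (EuclideanSpace ℝ (Fin d))) (x : EuclideanSpace ℝ (Fin d)) : Prop :=
  x ∈ feasibleSet g X ∧ IsMinOn f (feasibleSet g X) x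

/-- The Lagrange multiplier vectors at a feasible point `x`: the `y ≥ 0` that satisfy, together
with `x`, complementary slackness and stationarity. The KKT condition holds at `x` when this
set is nonempty. -/
def lagrangeMultipliers (f : EuclideanSpace ℝ (Fin d) → ℝ)
    (g : Fin m → EuclideanSpace ℝ (Fin d) → ℝ)
    (X : Set (EuclideanSpace ℝ (Fin d))) (x : EuclideanSpace ℝ (Fin d)) : Set (Fin m → ℝ) :=
  {y | (∀ i, 0 ≤ y i) ∧ (∀ i, y i * g i x = 0) ∧
    (0 : EuclideanSpace ℝ (Fin d)) ∈ subdifferential f x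
      + (∑ j : Fin m, y j • subdifferential (g j) x) + normalCone X x}

/-- Slater's condition: some point of `X` satisfies all the inequality constraints strictly. -/
def Slater (g : Fin m → EuclideanSpace ℝ (Fin d) → ℝ)
    (X : Set (EuclideanSpace ℝ (Fin d))) : Prop :=
  ∃ x ∈ X, ∀ i, g i x < 0

/-- Once `v(·, η₀)` attains its minimum over `X`, `V` is finite everywhere, i.e. `valueFun` is
a true greatest lower bound at every `η`. -/
theorem isGLB_valueFun (f : EuclideanSpace ℝ (Fin d) → ℝ)
    (g : Fin m → EuclideanSpace ℝ (Fin d) → ℝ) (X : Set (EuclideanSpace ℝ (Fin d)))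
    (η₀ : ℝ) (h : (solutionSet f g X η₀).Nonempty) (η : ℝ) :
    IsGLB ((fun x => maxFun f g x η) '' X) (valueFun f g X η) := by
  obtain ⟨x, hx, hmin⟩ := h
  refine isGLB_csInf ⟨_, x, hx, rfl⟩ ⟨maxFun f g x η₀ - |η - η₀|, ?_⟩
  rintro _ ⟨z, hz, rfl⟩
  have h1 : maxFun f g x η₀ ≤ maxFun f g z η₀ := hmin hz
  have h2 : maxFun f g z η₀ ≤ maxFun f g z η + |η - η₀| := by
    refine Finset.sup'_le _ _ fun i _ => ?_
    have h3 : piece f g z η i ≤ maxFun f g z η :=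
      Finset.le_sup' (piece f g z η) (Finset.mem_univ i)
    have h4 : piece f g z η₀ i ≤ piece f g z η i + |η - η₀| := by
      refine Fin.cases ?_ (fun j => ?_) i
      · simp only [piece, Fin.cons_zero]
        linarith [le_abs_self (η - η₀)]
      · simp only [piece, Fin.cons_succ]
        linarith [abs_nonneg (η - η₀)]
    linarith
  simp only
  linarith

end Problem

end LevelSet

end

/-! Both inclusions are weak duality. By `lagrangian_le_of_stationary`, a stationary point `x`
minimizes the Lagrangian over `X`, and a convex combination of the pieces never exceeds `v`, with
equality at `x` if the weights vanish on inactive pieces. Hence `v(y, η') ≥ v(x, η) - λ₀ (η' - η)`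
for all `y ∈ X`; the infimum over `y` is the subgradient inequality. For Lagrange multipliers the
weights `(1, y*)` are divided by `1 + ‖y*‖₁`; the resulting affine minorant of `V` vanishes exactly
at `f x*`, which also gives `η* = f x*`. Slater's condition calls for strong duality:
`exists_multipliers` yields all subgradients and the normal vector from a single Hahn–Banach
separation. -/

namespace LevelSet

/-! ### Separation of convex systems and subgradients -/

section Separation

variable {E : Type*} [NormedAddCommGroup E] [InnerProductSpace ℝ E] [CompleteSpace E]
  {ι : Type*} [Fintype ι]

/-- A finite system of convex inequalities without strict solution in `X` has decoupled
nontrivial multipliers. -/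
theorem exists_multipliers (h : ι → E → ℝ) (hconv : ∀ i, ConvexOn ℝ Set.univ (h i))
    (hcont : ∀ i, Continuous (h i)) {X : Set E} (hX : Convex ℝ X) (hne : X.Nonempty)
    (hno : ∀ x ∈ X, ∃ i, 0 ≤ h i x) :
    ∃ (l : ι → ℝ) (s : ι → E), (∀ i, 0 ≤ l i) ∧ l ≠ 0 ∧
      ∀ x ∈ X, ∀ z : ι → E, 0 ≤ ∑ i, (inner ℝ (s i) (z i - x) + l i * h i (z i)) := by
  classical
  -- Each inequality gets its own shift of the argument besides its slack, so the separating
  -- functional has a vector `s i` for each piece and no sum rule is needed.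
  let C : Set (ι → E × ℝ) := {w | ∃ x ∈ X, ∀ i, h i (x + (w i).1) < (w i).2}
  have hCopen : IsOpen C := by
    have : C = ⋃ x ∈ X, ⋂ i, {w : ι → E × ℝ | h i (x + (w i).1) < (w i).2} := by
      ext w; simp [C]
    rw [this]
    refine isOpen_biUnion fun x _ => isOpen_iInter_of_finite fun i => ?_
    have := hcont i
    exact isOpen_lt (by fun_prop) (by fun_prop)
  have hCconv : Convex ℝ C := by
    rintro w ⟨x, hx, hw⟩ w' ⟨x', hx', hw'⟩ a b ha hb hab
    refine ⟨a • x + b • x', hX hx hx' ha hb hab, fun i => ?_⟩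
    have h1 := (hconv i).2 (Set.mem_univ (x + (w i).1)) (Set.mem_univ (x' + (w' i).1)) ha hb hab
    have h2 : a • x + b • x' + ((a • w + b • w') i).1
        = a • (x + (w i).1) + b • (x' + (w' i).1) := by
      simp only [Pi.add_apply, Pi.smul_apply, Prod.fst_add, Prod.smul_fst, smul_add]; abel
    rw [h2]
    refine h1.trans_lt ?_
    simp only [Pi.add_apply, Pi.smul_apply, Prod.snd_add, Prod.smul_snd, smul_eq_mul]
    have h3 := hw i
    have h4 := hw' i
    rcases ha.eq_or_lt with rfl | ha'
    · obtain rfl : b = 1 := by linarith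
      linarith
    · nlinarith [mul_lt_mul_of_pos_left h3 ha', mul_le_mul_of_nonneg_left h4.le hb]
  have h0 : (0 : ι → E × ℝ) ∉ C := by
    rintro ⟨x, hx, hw⟩
    obtain ⟨i, hi⟩ := hno x hx
    have := hw i
    simp only [Pi.zero_apply, Prod.fst_zero, Prod.snd_zero, add_zero] at this
    linarith
  obtain ⟨φ, hφ⟩ := geometric_hahn_banach_open_point hCconv hCopen h0
  rw [map_zero] at hφ
  let L : ι → (E × ℝ) →L[ℝ] ℝ := fun i => φ.comp (ContinuousLinearMap.single ℝ (fun _ => E × ℝ) i)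
  let s : ι → E := fun i =>
    -(InnerProductSpace.toDual ℝ E).symm ((L i).comp (ContinuousLinearMap.inl ℝ E ℝ))
  let l : ι → ℝ := fun i => -L i (0, 1)
  have hφ_eq : ∀ w, φ w = -∑ i, (inner ℝ (s i) (w i).1 + l i * (w i).2) := by
    intro w
    have h1 : φ w = ∑ i, L i (w i) := by
      conv_lhs => rw [← Finset.univ_sum_single w, map_sum]
      rfl
    rw [h1, ← Finset.sum_neg_distrib]
    refine Finset.sum_congr rfl fun i _ => ?_
    have h2 : w i = ((w i).1, 0) + (w i).2 • ((0 : E), (1 : ℝ)) := by ext <;> simp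
    conv_lhs => rw [h2, map_add, map_smul]
    simp [s, l, inner_neg_left]
    ring
  have hpos : ∀ x ∈ X, ∀ z : ι → E, ∀ t : ι → ℝ, (∀ i, 0 < t i) →
      0 < ∑ i, (inner ℝ (s i) (z i - x) + l i * (h i (z i) + t i)) := by
    intro x hx z t ht
    have := hφ (fun i => (z i - x, h i (z i) + t i)) ⟨x, hx, fun i => by simpa using ht i⟩
    rw [hφ_eq] at this
    simpa using this
  -- Zero slacks are reached by a limit, at the price of strictness.
  have hlim : ∀ x ∈ X, ∀ z : ι → E, ∀ t : ι → ℝ, (∀ i, 0 ≤ t i) →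
      0 ≤ ∑ i, (inner ℝ (s i) (z i - x) + l i * (h i (z i) + t i)) := by
    intro x hx z t ht
    have hc : Continuous fun ε : ℝ =>
        ∑ i, (inner ℝ (s i) (z i - x) + l i * (h i (z i) + (t i + ε))) := by fun_prop
    have ht0 := (hc.tendsto 0).mono_left (nhdsWithin_le_nhds (s := Set.Ioi 0))
    simp only [add_zero] at ht0
    refine ge_of_tendsto ht0 ?_
    filter_upwards [self_mem_nhdsWithin] with ε hε
    exact (hpos x hx z _ fun i => add_pos_of_nonneg_of_pos (ht i) hε).le
  obtain ⟨x₀, hx₀⟩ := hne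
  refine ⟨l, s, fun i => ?_, fun hl => ?_, fun x hx z => ?_⟩
  -- If `l i < 0`, a large slack in coordinate `i` alone makes the sum negative.
  · by_contra! hneg
    set A := ∑ j, (inner ℝ (s j) (x₀ - x₀) + l j * h j x₀) with hA
    have h1 : ∀ T : ℝ, 0 ≤ T → 0 ≤ A + l i * T := by
      intro T hT
      have := hlim x₀ hx₀ (fun _ => x₀) (Pi.single i T) fun j => by
        by_cases hj : j = i
        · subst hj; simpa using hT
        · simp [hj]
      simp only [mul_add, ← add_assoc] at this
      rw [Finset.sum_add_distrib, ← hA] at this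
      simpa [Pi.single_apply] using this
    have h2 := h1 ((|A| + 1) / -l i) (by have := neg_pos.2 hneg; positivity)
    have h3 : l i * ((|A| + 1) / -l i) = -(|A| + 1) := by
      rw [div_neg, mul_neg, mul_div_cancel₀ _ hneg.ne]
    rw [h3] at h2
    linarith [le_abs_self A]
  -- With `l = 0` this choice of `z` gives `0 < -∑ ‖s i‖²`.
  · have h1 := hpos x₀ hx₀ (fun i => x₀ - s i) (fun _ => 1) fun _ => one_pos
    simp only [hl, Pi.zero_apply, zero_mul, add_zero, sub_sub_cancel_left, inner_neg_right,
      Finset.sum_neg_distrib] at h1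
    have h2 : 0 ≤ ∑ i, inner ℝ (s i) (s i) :=
      Finset.sum_nonneg fun i _ => real_inner_self_nonneg
    linarith
  · simpa using hlim x hx z 0 fun _ => le_rfl

/-- A continuous convex function has a subgradient everywhere. -/
theorem subdifferential_nonempty {h : E → ℝ} (hconv : ConvexOn ℝ Set.univ h)
    (hcont : Continuous h) (x : E) : (subdifferential h x).Nonempty := by
  obtain ⟨l, s, hl, hl0, H⟩ := exists_multipliers (ι := Unit) (fun _ z => h z - h x)
    (fun _ => hconv.sub (concaveOn_const _ convex_univ))
    (fun _ => hcont.sub continuous_const) (convex_singleton x) (Set.singleton_nonempty x)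
    (fun y hy => ⟨(), by rw [Set.mem_singleton_iff.1 hy, sub_self]⟩)
  have hpos : 0 < l () := (hl ()).lt_of_ne fun h0 => hl0 (funext fun _ => h0.symm)
  refine ⟨-(l ())⁻¹ • s (), fun y => ?_⟩
  have h1 := H x rfl fun _ => y
  simp only [Finset.univ_unique, PUnit.default_eq_unit, Finset.sum_singleton] at h1
  rw [inner_smul_left]
  have h2 := mul_nonneg (inv_nonneg.2 hpos.le) h1
  rw [mul_add, inv_mul_cancel_left₀ hpos.ne'] at h2
  simp only [conj_trivial]
  linarith

/-- A subgradient of `l • h` is `l` times a subgradient of `h`, also for `l = 0`. -/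
theorem mem_smul_subdifferential {h : E → ℝ} (hconv : ConvexOn ℝ Set.univ h)
    (hcont : Continuous h) {x : E} {l : ℝ} (hl : 0 ≤ l) {p : E}
    (hp : ∀ z, l * h x + inner ℝ p (z - x) ≤ l * h z) : p ∈ l • subdifferential h x := by
  rcases hl.eq_or_lt with rfl | hpos
  · have h1 := hp (x + p)
    simp only [zero_mul, add_sub_cancel_left, zero_add] at h1
    have h2 : p = 0 := real_inner_self_nonpos.1 h1
    -- `0 • ∂h(x)` is `{0}` rather than empty only because a subgradient exists.
    rw [h2, Set.zero_smul_set (subdifferential_nonempty hconv hcont x)]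
    rfl
  · rw [Set.mem_smul_set_iff_inv_smul_mem₀ hpos.ne']
    intro z
    have h2 := mul_le_mul_of_nonneg_left (hp z) (inv_nonneg.2 hpos.le)
    rw [mul_add, inv_mul_cancel_left₀ hpos.ne', inv_mul_cancel_left₀ hpos.ne'] at h2
    rwa [inner_smul_left]

end Separation

/-! ### Weak duality and affine minorants of the value function -/

section Problem

variable {d m : ℕ} {X : Set (EuclideanSpace ℝ (Fin d))}
  {f : EuclideanSpace ℝ (Fin d) → ℝ} {g : Fin m → EuclideanSpace ℝ (Fin d) → ℝ}

/-- Stationarity makes `x` a minimizer of the Lagrangian over `X`. -/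
theorem lagrangian_le_of_stationary {x : EuclideanSpace ℝ (Fin d)} {a : ℝ} {b : Fin m → ℝ}
    (ha : 0 ≤ a) (hb : ∀ j, 0 ≤ b j)
    (h0 : (0 : EuclideanSpace ℝ (Fin d)) ∈ a • subdifferential f x
      + (∑ j : Fin m, b j • subdifferential (g j) x) + normalCone X x)
    {y : EuclideanSpace ℝ (Fin d)} (hy : y ∈ X) :
    a * f x + ∑ j, b j * g j x ≤ a * f y + ∑ j, b j * g j y := by
  obtain ⟨q, ⟨_, ⟨p, hp, rfl⟩, _, hr₀, rfl⟩, n, hn, hsum⟩ := h0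
  obtain ⟨r, hr, rfl⟩ := (Set.mem_fintype_sum _ _).1 hr₀
  have h1 : ∀ j, b j * g j x + inner ℝ (r j) (y - x) ≤ b j * g j y := by
    intro j
    obtain ⟨t, ht, htr⟩ := hr j
    simp only at htr
    rw [← htr, inner_smul_left, conj_trivial, ← mul_add]
    exact mul_le_mul_of_nonneg_left (ht y) (hb j)
  have h2 := mul_le_mul_of_nonneg_left (hp y) ha
  have h3 := Finset.sum_le_sum fun j (_ : j ∈ Finset.univ) => h1 j
  rw [Finset.sum_add_distrib, ← sum_inner] at h3
  have h4 : inner ℝ n (x - y) = a * inner ℝ p (y - x) + inner ℝ (∑ j, r j) (y - x) := by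
    rw [← neg_sub y x, inner_neg_right, ← inner_neg_left, ← eq_neg_of_add_eq_zero_left hsum,
      inner_add_left, inner_smul_left, conj_trivial]
  have h5 := hn y hy
  linarith

theorem piece_le_maxFun (x : EuclideanSpace ℝ (Fin d)) (η : ℝ) (i : Fin (m + 1)) :
    piece f g x η i ≤ maxFun f g x η :=
  Finset.le_sup' (piece f g x η) (Finset.mem_univ i)

theorem sub_le_maxFun (x : EuclideanSpace ℝ (Fin d)) (η : ℝ) : f x - η ≤ maxFun f g x η := by
  simpa [piece] using piece_le_maxFun (f := f) (g := g) x η 0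

theorem constraint_le_maxFun (x : EuclideanSpace ℝ (Fin d)) (η : ℝ) (j : Fin m) :
    g j x ≤ maxFun f g x η :=
  piece_le_maxFun x η j.succ

theorem weighted_le_maxFun {a : ℝ} {b : Fin m → ℝ} (ha : 0 ≤ a) (hb : ∀ j, 0 ≤ b j)
    (x : EuclideanSpace ℝ (Fin d)) (η : ℝ) :
    a * (f x - η) + ∑ j, b j * g j x ≤ (a + ∑ j, b j) * maxFun f g x η := by
  rw [add_mul, Finset.sum_mul]
  exact add_le_add (mul_le_mul_of_nonneg_left (sub_le_maxFun x η) ha)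
    (Finset.sum_le_sum fun j _ => mul_le_mul_of_nonneg_left (constraint_le_maxFun x η j) (hb j))

theorem neg_mem_subdifferential_valueFun {x : EuclideanSpace ℝ (Fin d)} {η : ℝ}
    (hx : x ∈ solutionSet f g X η) {l : Fin (m + 1) → ℝ} (hl : l ∈ fritzJohn f g X x η) :
    -l 0 ∈ subdifferential (valueFun f g X) η := by
  obtain ⟨⟨⟨hnn, hone⟩, hact⟩, hst⟩ := hl
  rw [Fin.sum_univ_succ] at hone
  -- A real `sInf` bounds the values from below only if they are bounded below; the minimizer `x`
  -- ensures this.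
  have hle : valueFun f g X η ≤ maxFun f g x η :=
    (isGLB_valueFun f g X η ⟨x, hx⟩ η).1 ⟨x, hx.1, rfl⟩
  have hval : l 0 * (f x - η) + ∑ j : Fin m, l j.succ * g j x = maxFun f g x η := by
    have h1 : ∀ i, l i * piece f g x η i = l i * maxFun f g x η := by
      intro i
      rcases (piece_le_maxFun (f := f) (g := g) x η i).eq_or_lt with h | h
      · rw [h]
      · rw [hact i h, zero_mul, zero_mul]
    calc l 0 * (f x - η) + ∑ j : Fin m, l j.succ * g j x
        = ∑ i, l i * piece f g x η i := by rw [Fin.sum_univ_succ]; rfl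
      _ = maxFun f g x η := by
        simp_rw [h1]
        rw [← Finset.sum_mul, Fin.sum_univ_succ, hone, one_mul]
  intro η'
  refine le_csInf (Set.Nonempty.image _ ⟨x, hx.1⟩) ?_
  rintro _ ⟨y, hy, rfl⟩
  have h2 := lagrangian_le_of_stationary (hnn 0) (fun j => hnn j.succ) hst hy
  have h3 := weighted_le_maxFun (f := f) (g := g) (hnn 0) (fun j => hnn j.succ) y η'
  rw [hone, one_mul] at h3
  simp only [RCLike.inner_apply, conj_trivial]
  linarith

theorem IsOptimal.maxFun_nonneg {x : EuclideanSpace ℝ (Fin d)} (hx : IsOptimal f g X x)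
    {y : EuclideanSpace ℝ (Fin d)} (hy : y ∈ X) : 0 ≤ maxFun f g y (f x) := by
  by_contra! h
  have h1 : f x ≤ f y :=
    hx.2 ⟨hy, fun i => ((constraint_le_maxFun y (f x) i).trans_lt h).le⟩
  linarith [sub_le_maxFun (f := f) (g := g) y (f x)]

theorem IsOptimal.maxFun_eq_zero {x : EuclideanSpace ℝ (Fin d)} (hx : IsOptimal f g X x) :
    maxFun f g x (f x) = 0 := by
  refine le_antisymm (Finset.sup'_le _ _ fun i _ => ?_) (hx.maxFun_nonneg hx.1.1)
  refine Fin.cases ?_ (fun j => ?_) i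
  · simp [piece]
  · simpa [piece] using hx.1.2 j

theorem IsOptimal.valueFun_eq_zero {x : EuclideanSpace ℝ (Fin d)} (hx : IsOptimal f g X x) :
    valueFun f g X (f x) = 0 := by
  refine IsLeast.csInf_eq ⟨⟨x, hx.1.1, hx.maxFun_eq_zero⟩, ?_⟩
  rintro _ ⟨y, hy, rfl⟩
  exact hx.maxFun_nonneg hy

/-- This minorant is positive for `η < f x`, so `V` has no zero there; at an optimal `x` it touches
`V` at `η = f x`, so its slope is a subgradient. -/
theorem div_le_valueFun {x : EuclideanSpace ℝ (Fin d)} (hX : X.Nonempty) {y : Fin m → ℝ}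
    (hy : y ∈ lagrangeMultipliers f g X x) (η : ℝ) :
    (f x - η) / (1 + ∑ i, |y i|) ≤ valueFun f g X η := by
  obtain ⟨hnn, hcs, hst⟩ := hy
  refine le_csInf (hX.image _) ?_
  rintro _ ⟨z, hz, rfl⟩
  simp_rw [fun i => abs_of_nonneg (hnn i)]
  have hs : 0 < 1 + ∑ i, y i := by
    have := Finset.sum_nonneg fun i (_ : i ∈ Finset.univ) => hnn i
    linarith
  rw [div_le_iff₀ hs]
  have h1 := lagrangian_le_of_stationary zero_le_one hnn (by rwa [one_smul]) hz
  have h2 := weighted_le_maxFun (f := f) (g := g) zero_le_one hnn z η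
  simp_rw [hcs] at h1
  simp only [Finset.sum_const_zero] at h1
  linarith

theorem IsOptimal.etaStar_eq {x : EuclideanSpace ℝ (Fin d)} (hx : IsOptimal f g X x)
    (hy : (lagrangeMultipliers f g X x).Nonempty) : etaStar f g X = f x := by
  obtain ⟨y, hy⟩ := hy
  refine IsLeast.csInf_eq ⟨hx.valueFun_eq_zero, fun η hη => ?_⟩
  have h1 := div_le_valueFun ⟨x, hx.1.1⟩ hy η
  rw [show valueFun f g X η = 0 from hη, div_le_iff₀ (by positivity)] at h1
  linarith

theorem IsOptimal.neg_mem_subdifferential {x : EuclideanSpace ℝ (Fin d)}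
    (hx : IsOptimal f g X x) {y : Fin m → ℝ} (hy : y ∈ lagrangeMultipliers f g X x) :
    -(1 / (1 + ∑ i, |y i|)) ∈ subdifferential (valueFun f g X) (f x) := by
  intro η
  have h1 := div_le_valueFun ⟨x, hx.1.1⟩ hy η
  rw [hx.valueFun_eq_zero]
  simp only [RCLike.inner_apply, conj_trivial]
  refine le_trans (le_of_eq ?_) h1
  ring

/-! ### Existence of Lagrange multipliers under Slater's condition -/

theorem convexOn_piece (hf : ConvexOn ℝ Set.univ f) (hg : ∀ i, ConvexOn ℝ Set.univ (g i))
    (η : ℝ) (i : Fin (m + 1)) : ConvexOn ℝ Set.univ fun z => piece f g z η i := by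
  refine Fin.cases ?_ (fun j => ?_) i
  · exact hf.sub (concaveOn_const _ convex_univ)
  · simpa [piece] using hg j

theorem continuous_piece (hf : Continuous f) (hg : ∀ i, Continuous (g i))
    (η : ℝ) (i : Fin (m + 1)) : Continuous fun z => piece f g z η i := by
  refine Fin.cases ?_ (fun j => ?_) i
  · exact hf.sub continuous_const
  · simpa [piece] using hg j

/-- Optimality means that no point of `X` makes all pieces at level `f x` negative, so separation
applies. Slater's condition makes `l 0` positive, and division by it gives the multipliers. -/
theorem Slater.lagrangeMultipliers_nonempty (hX : Convex ℝ X)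
    (hf : ConvexOn ℝ Set.univ f) (hf_cont : Continuous f)
    (hg : ∀ i, ConvexOn ℝ Set.univ (g i)) (hg_cont : ∀ i, Continuous (g i))
    (hS : Slater g X) {x : EuclideanSpace ℝ (Fin d)} (hx : IsOptimal f g X x) :
    (lagrangeMultipliers f g X x).Nonempty := by
  obtain ⟨l, s, hl, hl0, H⟩ := exists_multipliers (fun i z => piece f g z (f x) i)
    (convexOn_piece hf hg _) (continuous_piece hf_cont hg_cont _) hX ⟨x, hx.1.1⟩ fun z hz => by
      by_contra! h
      exact absurd (hx.maxFun_nonneg hz) (not_le.2 ((Finset.sup'_lt_iff _).2 fun i _ => h i))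
  have hp : ∀ i, piece f g x (f x) i ≤ 0 := fun i =>
    (piece_le_maxFun x _ i).trans_eq hx.maxFun_eq_zero
  have hcs : ∀ i, l i * piece f g x (f x) i = 0 := by
    have h1 := H x hx.1.1 fun _ => x
    simp only [sub_self, inner_zero_right, zero_add] at h1
    have h2 : ∀ i ∈ Finset.univ, l i * piece f g x (f x) i ≤ 0 := fun i _ =>
      mul_nonpos_of_nonneg_of_nonpos (hl i) (hp i)
    exact fun i => (Finset.sum_eq_zero_iff_of_nonpos h2).1
      (le_antisymm (Finset.sum_nonpos h2) h1) i (Finset.mem_univ i)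
  have hsub : ∀ i z, 0 ≤ inner ℝ (s i) (z - x) + l i * piece f g z (f x) i := by
    intro i z
    -- Moving only the `i`-th argument away from `x` isolates the `i`-th subgradient inequality.
    have h1 := H x hx.1.1 (Function.update (fun _ => x) i z)
    rw [Finset.sum_eq_single i (fun j _ hj => by simp [hj, hcs]) (by simp)] at h1
    simpa using h1
  have hcone : ∑ i, s i ∈ normalCone X x := by
    intro z hz
    -- Moving only the base point isolates the normal cone condition.
    have h1 := H z hz fun _ => x
    simp_rw [hcs, add_zero] at h1
    rwa [sum_inner]
  have hl0pos : 0 < l 0 := by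
    refine (hl 0).lt_of_ne fun h0 => hl0 ?_
    have hs0 : s 0 = 0 := by
      have h1 := hsub 0 (x - s 0)
      rw [← h0, zero_mul, add_zero, sub_sub_cancel_left, inner_neg_right] at h1
      exact real_inner_self_nonpos.1 (neg_nonneg.1 h1)
    -- Placing the base point and all arguments at the Slater point leaves `0 ≤ ∑ lⱼ gⱼ(z)` with
    -- every `gⱼ(z) < 0`, so `l = 0`.
    obtain ⟨z, hz, hgz⟩ := hS
    have h1 := H z hz fun _ => z
    simp only [sub_self, inner_zero_right, zero_add] at h1
    rw [Fin.sum_univ_succ, ← h0, zero_mul, zero_add] at h1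
    have h2 : ∀ j ∈ Finset.univ, l (Fin.succ j) * piece f g z (f x) j.succ ≤ 0 := fun j _ =>
      mul_nonpos_of_nonneg_of_nonpos (hl _) (by simpa [piece] using (hgz j).le)
    funext i
    refine Fin.cases h0.symm (fun j => ?_) i
    have h3 := (Finset.sum_eq_zero_iff_of_nonpos h2).1
      (le_antisymm (Finset.sum_nonpos h2) h1) j (Finset.mem_univ j)
    exact (mul_eq_zero.1 h3).resolve_right (by simpa [piece] using (hgz j).ne)
  have hinv : 0 ≤ (l 0)⁻¹ := inv_nonneg.2 (hl 0)
  have hsubgrad : ∀ j : Fin m, -((l 0)⁻¹ • s j.succ) ∈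
      ((l 0)⁻¹ * l j.succ) • subdifferential (g j) x := fun j => by
    refine mem_smul_subdifferential (hg j) (hg_cont j) (mul_nonneg hinv (hl _)) fun z => ?_
    have h1 := mul_nonneg hinv (hsub j.succ z)
    have h2 := hcs j.succ
    simp only [piece, Fin.cons_succ] at h1 h2
    rw [mul_assoc, h2, inner_neg_left, inner_smul_left, conj_trivial]
    linarith
  refine ⟨fun j => (l 0)⁻¹ * l j.succ, fun j => mul_nonneg hinv (hl _), fun j => ?_, ?_⟩
  · have h1 := hcs j.succ
    simp only [piece, Fin.cons_succ] at h1
    rw [mul_assoc, h1, mul_zero]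
  · have hf0 : -((l 0)⁻¹ • s 0) ∈ subdifferential f x := by
      intro z
      have h1 := mul_nonneg hinv (hsub 0 z)
      simp only [piece, Fin.cons_zero] at h1
      rw [mul_add, inv_mul_cancel_left₀ hl0pos.ne'] at h1
      rw [inner_neg_left, inner_smul_left, conj_trivial]
      linarith
    have hn : (l 0)⁻¹ • ∑ i, s i ∈ normalCone X x := by
      intro z hz
      rw [inner_smul_left, conj_trivial]
      exact mul_nonneg hinv (hcone z hz)
    have hsum : -((l 0)⁻¹ • s 0) + ∑ j : Fin m, -((l 0)⁻¹ • s j.succ) + (l 0)⁻¹ • ∑ i, s i = 0 := by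
      rw [Fin.sum_univ_succ, smul_add, Finset.smul_sum, Finset.sum_neg_distrib]
      abel
    rw [← hsum]
    exact Set.add_mem_add (Set.add_mem_add hf0
      ((Set.mem_fintype_sum _ _).2 ⟨_, hsubgrad, rfl⟩)) hn

end Problem

end LevelSet

theorem mainTheorem5 {d m : ℕ}
    (X : Set (EuclideanSpace ℝ (Fin d)))
    (hX_closed : IsClosed X) (hX_convex : Convex ℝ X) (hX_nonempty : X.Nonempty)
    (f : EuclideanSpace ℝ (Fin d) → ℝ) (g : Fin m → EuclideanSpace ℝ (Fin d) → ℝ)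
    (hf : ConvexOn ℝ Set.univ f) (hf_cont : Continuous f)
    (hg : ∀ i, ConvexOn ℝ Set.univ (g i)) (hg_cont : ∀ i, Continuous (g i)) :
    (∀ η : ℝ,
      (⋃ x ∈ LevelSet.solutionSet f g X η,
        {s : ℝ | ∃ l ∈ LevelSet.fritzJohn f g X x η, s = -l 0})
        ⊆ LevelSet.subdifferential (LevelSet.valueFun f g X) η) ∧
    (∀ x, LevelSet.IsOptimal f g X x → (LevelSet.lagrangeMultipliers f g X x).Nonempty →
      LevelSet.etaStar f g X = f x ∧
      {s : ℝ | ∃ y ∈ LevelSet.lagrangeMultipliers f g X x, s = -(1 / (1 + ∑ i, |y i|))}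
        ⊆ LevelSet.subdifferential (LevelSet.valueFun f g X) (LevelSet.etaStar f g X)) ∧
    (LevelSet.Slater g X →
      ∀ x, LevelSet.IsOptimal f g X x → (LevelSet.lagrangeMultipliers f g X x).Nonempty) := by
  refine ⟨fun η => ?_, fun x hx hy => ?_, fun hS x hx =>
    hS.lagrangeMultipliers_nonempty hX_convex hf hf_cont hg hg_cont hx⟩
  · simp only [Set.iUnion_subset_iff]
    rintro x hx _ ⟨l, hl, rfl⟩
    exact LevelSet.neg_mem_subdifferential_valueFun hx hl
  · rw [hx.etaStar_eq hy]
    refine ⟨rfl, ?_⟩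
    rintro _ ⟨y, hy, rfl⟩
    exact hx.neg_mem_subdifferential hy
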